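/- Let $f:\mathbb{C}\to\mathbb{C}$ be a transcendental entire function. The Fatou set of $f$ is the set of points $z\in\mathbb{C}$ having a neighbourhood on which the family of iterates $\{f^n\}_{n>0}$ is normal, that is, every sequence in the family has a subsequence converging, uniformly on compact subsets, either to a finite limit function or to $\infty$; its connected components are the Fatou components. For a Fatou component $U$ let $U_n$ be the Fatou component containing $f^n(U)$. A Baker wandering domain of $f$ is a Fatou component $U$ such that $U_n\neq U_m$ for all $n\neq m$; for all sufficiently large $n$ the component $U_n$ is bounded, multiply connected and surrounds $0$ (that is, $0$ lies in a bounded component of $\widehat{\mathbb{C}}\setminus U_n$); and $f^n(z)\to\infty$ as $n\to\infty$ for every $z\in U$. A point $a\in\widehat{\mathbb{C}}$ is a Baker omitted value (bov) of $f$ if $f(z)\neq a$ for all $z\in\mathbb{C}$ and there is $r_0>0$ such that for every $r$ with $0<r<r_0$ each connected component of the boundary of $f^{-1}(D_r(a))$ in $\mathbb{C}$ is bounded, where $D_r(a)$ is the open ball of centre $a$ and radius $r$ in the spherical metric of $\widehat{\mathbb{C}}$. If $f$ has a Baker wandering domain, then $\infty$ is the Baker omitted value of $f$; that is, $\infty$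 is a Baker omitted value of $f$ and $f$ has no other. -/

import Mathlib

open Set Filter Topology

noncomputable section

namespace BakerOmitted

/-- A transcendental entire function: holomorphic on the whole plane and not a polynomial. -/
def IsTranscendentalEntire (f : ℂ → ℂ) : Prop :=
  Differentiable ℂ f ∧ ¬ ∃ p : Polynomial ℂ, ∀ z, f z = p.eval z

/-! ### The Riemann sphere and Baker omitted values -/

/-- The chordal distance on the Riemann sphere `OnePoint ℂ` (the unit sphere of `ℝ³`,
seen through stereographic projection). -/
def chordalDist : OnePoint ℂ → OnePoint ℂ → ℝ
  | none, none => 0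
  | none, some w => 2 / √(1 + ‖w‖ ^ 2)
  | some z, none => 2 / √(1 + ‖z‖ ^ 2)
  | some z, some w => 2 * ‖z - w‖ / (√(1 + ‖z‖ ^ 2) * √(1 + ‖w‖ ^ 2))

theorem chordalDist_coe_coe (z w : ℂ) : chordalDist z w =
    2 * ‖z - w‖ / (√(1 + ‖z‖ ^ 2) * √(1 + ‖w‖ ^ 2)) := rfl

theorem chordalDist_coe_infty (z : ℂ) :
    chordalDist z OnePoint.infty = 2 / √(1 + ‖z‖ ^ 2) := rfl

theorem chordalDist_infty_coe (w : ℂ) :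
    chordalDist OnePoint.infty w = 2 / √(1 + ‖w‖ ^ 2) := rfl

theorem chordalDist_infty_infty : chordalDist OnePoint.infty OnePoint.infty = 0 := rfl

/-- The spherical distance on the Riemann sphere: the length of the great circle arc that
subtends a chord of the given length on the unit sphere. -/
def sphericalDist (p q : OnePoint ℂ) : ℝ :=
  2 * Real.arcsin (chordalDist p q / 2)

/-- The open ball `D_r(a)` with respect to the spherical metric. -/
def sphericalBall (a : OnePoint ℂ) (r : ℝ) : Set (OnePoint ℂ) :=
  {p | sphericalDist p a < r}

/-- `a` is omitted by `f : ℂ → Ĉ`, and for all small `r > 0` each connected component of the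
boundary (in `ℂ`) of `f⁻¹(D_r(a))` is bounded. -/
def IsBakerOmittedValue (f : ℂ → OnePoint ℂ) (a : OnePoint ℂ) : Prop :=
  (∀ z, f z ≠ a) ∧
    ∃ r₀ : ℝ, 0 < r₀ ∧ ∀ r : ℝ, 0 < r → r < r₀ →
      ∀ x ∈ frontier (f ⁻¹' sphericalBall a r),
        Bornology.IsBounded (connectedComponentIn (frontier (f ⁻¹' sphericalBall a r)) x)

/-! ### Fatou components -/

/-- Every sequence in the family has a subsequence that converges, uniformly on each compact
subset of `Ω`, either to a finite limit function or to `∞`. -/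
def IsNormalFamilyOn (F : Set (ℂ → ℂ)) (Ω : Set ℂ) : Prop :=
  ∀ s : ℕ → ℂ → ℂ, (∀ k, s k ∈ F) →
    ∃ φ : ℕ → ℕ, StrictMono φ ∧
      ((∃ g : ℂ → ℂ, ∀ K ⊆ Ω, IsCompact K →
          TendstoUniformlyOn (fun k => s (φ k)) g atTop K) ∨
        (∀ K ⊆ Ω, IsCompact K → ∀ R : ℝ, ∀ᶠ k in atTop, ∀ z ∈ K, R < ‖s (φ k) z‖))

/-- The Fatou set: points with a neighbourhood, taken to be a domain, on which the iterates
`f^n`, `n > 0`, form a normal family. -/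
def fatouSet (f : ℂ → ℂ) : Set ℂ :=
  {z | ∃ Ω : Set ℂ, IsOpen Ω ∧ IsConnected Ω ∧ z ∈ Ω ∧
    IsNormalFamilyOn {g | ∃ n : ℕ, 0 < n ∧ g = f^[n]} Ω}

/-- A Fatou component: a connected component of the Fatou set. -/
def IsFatouComponent (f : ℂ → ℂ) (U : Set ℂ) : Prop :=
  ∃ z ∈ fatouSet f, U = connectedComponentIn (fatouSet f) z

/-- `U_k`, the Fatou component that contains `f^k(U)`. -/
def iterComponent (f : ℂ → ℂ) (U : Set ℂ) (k : ℕ) : Set ℂ :=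
  ⋃₀ {W | IsFatouComponent f W ∧ f^[k] '' U ⊆ W}

/-- `iterComponent f U k` really is the one Fatou component containing `f^k(U)`. -/
theorem iterComponent_eq {f : ℂ → ℂ} {U W : Set ℂ} {k : ℕ} (hU : U.Nonempty)
    (hW : IsFatouComponent f W) (h : f^[k] '' U ⊆ W) : iterComponent f U k = W := by
  obtain ⟨x, hx⟩ := hU
  have key : ∀ V, IsFatouComponent f V → f^[k] '' U ⊆ V →
      V = connectedComponentIn (fatouSet f) (f^[k] x) := by
    rintro V ⟨z, -, rfl⟩ hV
    exact connectedComponentIn_eq (hV ⟨x, hx, rfl⟩)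
  refine Subset.antisymm (sUnion_subset ?_) (subset_sUnion_of_mem ⟨hW, h⟩)
  rintro V ⟨hV, hkV⟩
  rw [key V hV hkV, ← key W hW h]

/-- A connected but not simply connected plane set. -/
def IsMultiplyConnected (U : Set ℂ) : Prop :=
  IsConnected U ∧ ¬ IsSimplyConnected U

/-- `U` surrounds `a`: the point `a` lies in a bounded component of `Ĉ \ U`, that is, in a
component which is a bounded subset of the plane. -/
def Surrounds (U : Set ℂ) (a : ℂ) : Prop :=
  a ∉ U ∧ ∃ B : Set ℂ, Bornology.IsBounded B ∧
    connectedComponentIn (((↑) '' U : Set (OnePoint ℂ))ᶜ) (a : OnePoint ℂ) = (↑) '' B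

/-- A wandering Fatou component: the components `U_n` are pairwise distinct. -/
def IsWandering (f : ℂ → ℂ) (U : Set ℂ) : Prop :=
  IsFatouComponent f U ∧ ∀ m n : ℕ, m ≠ n → iterComponent f U m ≠ iterComponent f U n

/-- A Baker wandering domain: a wandering component `U` such that `U_n` is bounded, multiply
connected and surrounds `0` for all large `n`, and `f^n → ∞` on `U`. -/
def IsBakerWanderingDomain (f : ℂ → ℂ) (U : Set ℂ) : Prop :=
  IsWandering f U ∧
    (∀ᶠ n in atTop, Bornology.IsBounded (iterComponent f U n) ∧
      IsMultiplyConnected (iterComponent f U n) ∧ Surrounds (iterComponent f U n) 0) ∧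
    ∀ z ∈ U, Tendsto (fun n : ℕ => f^[n] z) atTop (Bornology.cobounded ℂ)

end BakerOmitted

end

/-! Everything rests on `IsBakerWanderingDomain.exists_isOpen_isBounded`: for each `R` some bounded
open set contains the closed ball of radius `R` about `0` and has `R < ‖f‖` on its frontier. Some `V
= U_N` surrounds `0`, so `0` has a bounded neighbourhood `G` with frontier in `V`. By normality that
compact frontier escapes uniformly. `G` itself does not: otherwise it would lie in the Fatou set and
join `0` to `V`. So for suitable `k`, `f^k(G)` meets a fixed ball while `f^k` and `f^(k+1)` are
large on `∂G`. Since `f^k` is open, `∂f^k(G) ⊆ f^k(∂G)`, and `f^k(G)` is the required set. Such sets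
trap every connected set on which `f` is bounded, which makes `∞` a Baker omitted value. If `f`
omitted a finite `a`, the maximum principle on them would force `1/(f - a)` to vanish at `0`; so no
finite value is omitted. -/

namespace BakerOmitted

/-! ### Topological preliminaries -/

/-- In a compact Hausdorff space, a point outside the component of `x` in a closed set `K` is
separated from `x` by an open set whose frontier avoids `K`. -/
theorem exists_isOpen_frontier_disjoint {X : Type*} [TopologicalSpace X] [CompactSpace X]
    [T2Space X] {K : Set X} (hK : IsClosed K) {x y : X} (hx : x ∈ K) (hyK : y ∈ K)
    (hy : y ∉ connectedComponentIn K x) :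
    ∃ W : Set X, IsOpen W ∧ x ∈ W ∧ y ∉ closure W ∧ Disjoint (frontier W) K := by
  have : CompactSpace K := isCompact_iff_compactSpace.1 hK.isCompact
  have hy' : (⟨y, hyK⟩ : K) ∉ connectedComponent (⟨x, hx⟩ : K) := by
    rw [connectedComponentIn_eq_image hx] at hy
    exact fun h => hy ⟨_, h, rfl⟩
  -- In a compact Hausdorff space components are quasi-components, so a clopen piece of `K`
  -- separates the points; normality then thickens it to an open set of `X`.
  rw [connectedComponent_eq_iInter_isClopen, mem_iInter] at hy'
  push Not at hy'
  obtain ⟨⟨s, hs, hxs⟩, hys⟩ := hy'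
  have hE : IsClosed (Subtype.val '' s : Set X) := hK.isClosedMap_subtype_val _ hs.1
  have hE' : IsClosed (Subtype.val '' sᶜ : Set X) := hK.isClosedMap_subtype_val _ hs.compl.1
  obtain ⟨W, hWo, hEW, hWE⟩ := normal_exists_closure_subset hE hE'.isOpen_compl (by
    rintro _ ⟨p, hp, rfl⟩ ⟨q, hq, hqp⟩
    exact hq (Subtype.ext hqp ▸ hp))
  refine ⟨W, hWo, hEW ⟨_, hxs, rfl⟩, fun h => hWE h ⟨_, hys, rfl⟩, ?_⟩
  rw [disjoint_left]
  intro p hp hpK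
  by_cases hps : (⟨p, hpK⟩ : K) ∈ s
  · exact (hWo.frontier_eq ▸ hp).2 (hEW ⟨_, hps, rfl⟩)
  · exact hWE hp.1 ⟨_, hps, rfl⟩

/-- An open set that surrounds `a` contains the frontier of a bounded neighbourhood of `a`. -/
theorem Surrounds.exists_isOpen_isBounded {V : Set ℂ} {a : ℂ} (hV : IsOpen V)
    (h : Surrounds V a) :
    ∃ G : Set ℂ, IsOpen G ∧ Bornology.IsBounded G ∧ a ∈ G ∧ frontier G ⊆ V := by
  obtain ⟨haV, B, -, hB⟩ := h
  have haK : (a : OnePoint ℂ) ∈ (((↑) '' V : Set (OnePoint ℂ))ᶜ) := by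
    rintro ⟨v, hv, hva⟩
    exact haV (OnePoint.coe_injective hva ▸ hv)
  -- Separating from `∞` on the sphere keeps `closure W` inside a compact part of the plane.
  obtain ⟨W, hWo, haW, hW, hfr⟩ := exists_isOpen_frontier_disjoint
    (OnePoint.isOpen_image_coe.2 hV).isClosed_compl haK (y := OnePoint.infty)
    (by simp) (by rw [hB]; simp)
  have hc : IsCompact ((↑) ⁻¹' closure W : Set ℂ) := by
    refine OnePoint.isOpenEmbedding_coe.isInducing.isCompact_preimage' isClosed_closure.isCompact ?_
    exact fun p hp => OnePoint.ne_infty_iff_exists.1 fun h => hW (h ▸ hp)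
  refine ⟨((↑) : ℂ → OnePoint ℂ) ⁻¹' W, hWo.preimage OnePoint.continuous_coe,
    hc.isBounded.subset (preimage_mono subset_closure), haW, fun z hz => ?_⟩
  have hz' := OnePoint.continuous_coe.frontier_preimage_subset W hz
  by_contra hzV
  refine disjoint_left.1 hfr hz' ?_
  rintro ⟨v, hv, hvz⟩
  exact hzV (OnePoint.coe_injective hvz ▸ hv)

/-- A connected set that meets `G` but not its frontier lies in `G`. -/
theorem _root_.IsPreconnected.subset_of_disjoint_frontier {X : Type*} [TopologicalSpace X]
    {C G : Set X} (hC : IsPreconnected C) (hG : IsOpen G) (hne : (C ∩ G).Nonempty)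
    (hd : Disjoint C (frontier G)) : C ⊆ G := by
  refine hC.subset_left_of_subset_union hG isClosed_closure.isOpen_compl
    (disjoint_compl_right.mono_left subset_closure) (fun z hz => ?_) hne
  by_cases h : z ∈ closure G
  · by_contra h'
    exact disjoint_left.1 hd hz (hG.frontier_eq ▸ ⟨h, fun hzG => h' (Or.inl hzG)⟩)
  · exact Or.inr h

/-- An open continuous map does not create frontier points of bounded sets. -/
theorem _root_.IsOpenMap.frontier_image_subset {g : ℂ → ℂ} (hg : IsOpenMap g)
    (hc : Continuous g) {G : Set ℂ} (hG : IsOpen G) (hb : Bornology.IsBounded G) :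
    frontier (g '' G) ⊆ g '' frontier G := by
  intro w hw
  rw [(hg _ hG).frontier_eq] at hw
  have hcl : closure (g '' G) ⊆ g '' closure G :=
    closure_minimal (image_mono subset_closure) (hb.isCompact_closure.image hc).isClosed
  obtain ⟨z, hz, rfl⟩ := hcl hw.1
  exact ⟨z, hG.frontier_eq ▸ ⟨hz, fun h => hw.2 ⟨z, h, rfl⟩⟩, rfl⟩

/-! ### The Fatou set and escaping points -/

theorem isOpen_fatouSet (f : ℂ → ℂ) : IsOpen (fatouSet f) := by
  rw [isOpen_iff_forall_mem_open]
  rintro z ⟨Ω, ho, hc, hz, hn⟩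
  exact ⟨Ω, fun w hw => ⟨Ω, ho, hc, hw, hn⟩, ho, hz⟩

/-- The iterates of `f` tend to `∞` uniformly on `S`. -/
def EscapesUniformlyOn (f : ℂ → ℂ) (S : Set ℂ) : Prop :=
  ∀ R : ℝ, ∀ᶠ k : ℕ in atTop, ∀ z ∈ S, R < ‖f^[k] z‖

theorem escapesUniformlyOn_singleton {f : ℂ → ℂ} {z : ℂ} :
    EscapesUniformlyOn f {z} ↔
      Tendsto (fun n : ℕ => f^[n] z) atTop (Bornology.cobounded ℂ) := by
  rw [← tendsto_norm_atTop_iff_cobounded, tendsto_atTop]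
  simp only [EscapesUniformlyOn, mem_singleton_iff, forall_eq]
  refine ⟨fun h R => (h R).mono fun _ => le_of_lt, fun h R => (h (R + 1)).mono fun _ hk => ?_⟩
  linarith

theorem EscapesUniformlyOn.mono {f : ℂ → ℂ} {S T : Set ℂ} (h : EscapesUniformlyOn f T)
    (hST : S ⊆ T) : EscapesUniformlyOn f S :=
  fun R => (h R).mono fun _ hk z hz => hk z (hST hz)

/-- On a set of normality containing one escaping point, all compact subsets escape. -/
theorem EscapesUniformlyOn.of_isNormalFamilyOn {f : ℂ → ℂ} {Ω K : Set ℂ} {w : ℂ}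
    (hn : IsNormalFamilyOn {g | ∃ n : ℕ, 0 < n ∧ g = f^[n]} Ω) (hw : w ∈ Ω)
    (hesc : EscapesUniformlyOn f {w}) (hKΩ : K ⊆ Ω) (hK : IsCompact K) :
    EscapesUniformlyOn f K := by
  intro R
  by_contra hR
  -- Along `ν` the set `K` never clears `R`. A finite limit is excluded at `w`, and the limit `∞` by
  -- the choice of `ν`.
  obtain ⟨ν, hν, hνR⟩ := extraction_of_frequently_atTop
    ((not_eventually.1 hR).and_eventually (eventually_gt_atTop 0))
  obtain ⟨φ, hφ, ⟨g, hg⟩ | hinf⟩ := hn (fun k => f^[ν k]) fun k => ⟨_, (hνR k).2, rfl⟩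
  · have h1 : Tendsto (fun k => f^[ν (φ k)] w) atTop (𝓝 (g w)) :=
      (hg {w} (singleton_subset_iff.2 hw) isCompact_singleton).tendsto_at rfl
    have h2 : Tendsto (fun k => f^[ν (φ k)] w) atTop (Bornology.cobounded ℂ) :=
      (escapesUniformlyOn_singleton.1 hesc).comp (hν.comp hφ).tendsto_atTop
    exact not_tendsto_nhds_of_tendsto_atTop (tendsto_norm_atTop_iff_cobounded.2 h2) _ h1.norm
  · obtain ⟨k, hk⟩ := (hinf K hKΩ hK R).exists
    exact (hνR (φ k)).1 hk

/-- If one point of a Fatou component escapes, then so does every compact subset of it. -/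
theorem IsFatouComponent.escapesUniformlyOn {f : ℂ → ℂ} {V K : Set ℂ} {w : ℂ}
    (hV : IsFatouComponent f V) (hw : w ∈ V) (hesc : EscapesUniformlyOn f {w})
    (hKV : K ⊆ V) (hK : IsCompact K) : EscapesUniformlyOn f K := by
  have hVF : V ⊆ fatouSet f := by
    obtain ⟨z, -, rfl⟩ := hV
    exact connectedComponentIn_subset _ _
  have hVc : IsPreconnected V := by
    obtain ⟨z, -, rfl⟩ := hV
    exact isPreconnected_connectedComponentIn
  have hpt : ∀ z ∈ V, EscapesUniformlyOn f {z} := by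
    -- Normality makes escaping and not escaping both open conditions on the connected set `V`.
    let A : Set ℂ := {z | ∃ Ω, IsOpen Ω ∧ z ∈ Ω ∧ ∀ v ∈ Ω, EscapesUniformlyOn f {v}}
    let B : Set ℂ := {z | ∃ Ω, IsOpen Ω ∧ z ∈ Ω ∧ ∀ v ∈ Ω, ¬ EscapesUniformlyOn f {v}}
    have hA : IsOpen A := isOpen_iff_forall_mem_open.2 fun z ⟨Ω, ho, hz, h⟩ =>
      ⟨Ω, fun v hv => ⟨Ω, ho, hv, h⟩, ho, hz⟩
    have hB : IsOpen B := isOpen_iff_forall_mem_open.2 fun z ⟨Ω, ho, hz, h⟩ =>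
      ⟨Ω, fun v hv => ⟨Ω, ho, hv, h⟩, ho, hz⟩
    have key : ∀ z ∈ V, (EscapesUniformlyOn f {z} → z ∈ A) ∧
        (¬ EscapesUniformlyOn f {z} → z ∈ B) := by
      intro z hz
      obtain ⟨Ω, ho, -, hzΩ, hn⟩ := hVF hz
      refine ⟨fun h => ⟨Ω, ho, hzΩ, fun v hv => ?_⟩, fun h => ⟨Ω, ho, hzΩ, fun v hv hv' => h ?_⟩⟩
      · exact h.of_isNormalFamilyOn hn hzΩ (singleton_subset_iff.2 hv) isCompact_singleton
      · exact hv'.of_isNormalFamilyOn hn hv (singleton_subset_iff.2 hzΩ) isCompact_singleton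
    have hAB : Disjoint A B := disjoint_left.2 fun z ⟨_, _, hz, h⟩ ⟨_, _, hz', h'⟩ =>
      h' z hz' (h z hz)
    have hsub : V ⊆ A := hVc.subset_left_of_subset_union hA hB hAB
      (fun z hz => (em _).imp (key z hz).1 (key z hz).2) ⟨w, hw, (key w hw).1 hesc⟩
    intro z hz
    obtain ⟨Ω, -, hzΩ, h⟩ := hsub hz
    exact h z hzΩ
  refine hK.induction_on (p := EscapesUniformlyOn f) (fun R => by simp)
    (fun s t hst ht => ht.mono hst) (fun s t hs ht R => ?_) (fun z hz => ?_)
  · filter_upwards [hs R, ht R] with k h1 h2 z hz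
    exact hz.elim (h1 z) (h2 z)
  · obtain ⟨Ω, ho, -, hzΩ, hn⟩ := hVF (hKV hz)
    obtain ⟨L, hL, hzL, hLΩ⟩ := exists_compact_subset ho hzΩ
    exact ⟨L, mem_nhdsWithin_of_mem_nhds (mem_interior_iff_mem_nhds.1 hzL),
      (hpt z (hKV hz)).of_isNormalFamilyOn hn hzΩ hLΩ hL⟩

/-- A sequence of natural numbers is constant along a subsequence or tends to infinity along
one. -/
theorem exists_strictMono_const_or_tendsto (n : ℕ → ℕ) :
    ∃ φ : ℕ → ℕ, StrictMono φ ∧ ((∃ m, ∀ k, n (φ k) = m) ∨ Tendsto (n ∘ φ) atTop atTop) := by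
  by_cases h : Tendsto n atTop atTop
  · exact ⟨id, strictMono_id, Or.inr h⟩
  · rw [tendsto_atTop] at h
    push Not at h
    obtain ⟨b, hb⟩ := h
    have : ∃ m, ∃ᶠ k in atTop, n k = m := by
      by_contra hm
      push Not at hm
      refine hb ?_
      filter_upwards [(finite_Iio b).eventually_all.2 fun m _ => hm m] with k hk
      exact fun hlt => hk (n k) (mem_Iio.2 hlt) rfl
    obtain ⟨m, hm⟩ := this
    obtain ⟨φ, hφ, h⟩ := extraction_of_frequently_atTop hm
    exact ⟨φ, hφ, Or.inl ⟨m, h⟩⟩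

/-- A domain that escapes uniformly lies in the Fatou set. -/
theorem EscapesUniformlyOn.subset_fatouSet {f : ℂ → ℂ} {Ω : Set ℂ}
    (h : EscapesUniformlyOn f Ω) (ho : IsOpen Ω) (hc : IsConnected Ω) : Ω ⊆ fatouSet f := by
  refine fun z hz => ⟨Ω, ho, hc, hz, fun s hs => ?_⟩
  choose n _ hn using hs
  obtain ⟨φ, hφ, ⟨m, hm⟩ | ht⟩ := exists_strictMono_const_or_tendsto n
  · refine ⟨φ, hφ, Or.inl ⟨f^[m], fun K _ _ => ?_⟩⟩
    simp only [hn, hm]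
    exact fun u hu => Eventually.of_forall fun _ _ _ => refl_mem_uniformity hu
  · refine ⟨φ, hφ, Or.inr fun K hK _ R => ?_⟩
    filter_upwards [ht.eventually (h R)] with k hk w hw
    rw [hn]
    exact hk w (hK hw)

/-- A bounded neighbourhood of a point outside a Fatou component `V`, with frontier in `V`, does
not escape uniformly. -/
theorem IsFatouComponent.not_escapesUniformlyOn {f : ℂ → ℂ} {V G : Set ℂ} {a : ℂ}
    (hV : IsFatouComponent f V) (hG : IsOpen G) (hb : Bornology.IsBounded G) (haG : a ∈ G)
    (haV : a ∉ V) (hfr : frontier G ⊆ V) : ¬ EscapesUniformlyOn f G := by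
  intro h
  obtain ⟨z, -, rfl⟩ := hV
  have hVo : IsOpen (connectedComponentIn (fatouSet f) z) :=
    (isOpen_fatouSet f).connectedComponentIn
  set D := connectedComponentIn G a
  have hDo : IsOpen D := hG.connectedComponentIn
  have haD : a ∈ D := mem_connectedComponentIn haG
  have hDc : IsConnected D := isConnected_connectedComponentIn_iff.2 haG
  have hDG : D ⊆ G := connectedComponentIn_subset _ _
  have hDF : D ⊆ fatouSet f := (h.mono hDG).subset_fatouSet hDo hDc
  obtain ⟨p, hp⟩ : (frontier D).Nonempty := by
    refine nonempty_frontier_iff.2 ⟨⟨a, haD⟩, fun hu => ?_⟩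
    exact NormedSpace.unbounded_univ ℂ ℂ (hu ▸ hb.subset hDG)
  rw [hDo.frontier_eq] at hp
  -- Components of `G` are relatively closed in `G`, so `p` lies on `∂G ⊆ V`; hence `D` meets `V`.
  have hpG : p ∉ G := fun hpG => by
    have hsub : insert p D ⊆ D := (hDc.isPreconnected.subset_closure (subset_insert _ _)
      (insert_subset hp.1 subset_closure)).subset_connectedComponentIn (mem_insert_of_mem _ haD)
      (insert_subset hpG hDG)
    exact hp.2 (hsub (mem_insert _ _))
  have hpV : p ∈ connectedComponentIn (fatouSet f) z := hfr (hG.frontier_eq.symm ▸ ⟨closure_mono hDG hp.1, hpG⟩)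
  obtain ⟨q, hqV, hqD⟩ := mem_closure_iff.1 hp.1 _ hVo hpV
  have := hDc.isPreconnected.subset_connectedComponentIn hqD hDF haD
  rw [← connectedComponentIn_eq hqV] at this
  exact haV this

/-! ### Bounded domains on whose frontier `f` is large -/

theorem IsTranscendentalEntire.isOpenMap {f : ℂ → ℂ} (hf : IsTranscendentalEntire f) :
    IsOpenMap f := by
  refine (AnalyticOnNhd.is_constant_or_isOpenMap
    (Complex.analyticOnNhd_univ_iff_differentiable.2 hf.1)).resolve_left ?_
  rintro ⟨w, hw⟩
  exact hf.2 ⟨Polynomial.C w, by simpa using hw⟩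

theorem IsTranscendentalEntire.isOpenMap_iterate {f : ℂ → ℂ} (hf : IsTranscendentalEntire f)
    (k : ℕ) : IsOpenMap f^[k] := by
  induction k with
  | zero => exact IsOpenMap.id
  | succ k ih => exact ih.comp hf.isOpenMap

theorem IsBakerWanderingDomain.exists_isOpen_isBounded {f : ℂ → ℂ} {U : Set ℂ}
    (hf : IsTranscendentalEntire f) (hU : IsBakerWanderingDomain f U) (R : ℝ) :
    ∃ G : Set ℂ, IsOpen G ∧ Bornology.IsBounded G ∧ Metric.closedBall 0 R ⊆ G ∧
      ∀ z ∈ frontier G, R < ‖f z‖ := by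
  obtain ⟨⟨⟨u, hu, hUu⟩, -⟩, hev, hesc⟩ := hU
  have huU : u ∈ U := hUu ▸ mem_connectedComponentIn hu
  obtain ⟨N, -, ⟨⟨hne, -⟩, -⟩, hsur⟩ := hev.exists
  obtain ⟨V, hV, hNV, hVeq⟩ : ∃ V, IsFatouComponent f V ∧ f^[N] '' U ⊆ V ∧
      iterComponent f U N = V := by
    obtain ⟨x, W, ⟨hW, hNW⟩, -⟩ := hne
    exact ⟨W, hW, hNW, iterComponent_eq ⟨u, huU⟩ hW hNW⟩
  rw [hVeq] at hsur
  have hVo : IsOpen V := by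
    obtain ⟨z, -, rfl⟩ := hV
    exact (isOpen_fatouSet f).connectedComponentIn
  obtain ⟨G, hG, hb, h0, hfr⟩ := hsur.exists_isOpen_isBounded hVo
  have hw : EscapesUniformlyOn f {f^[N] u} := by
    rw [escapesUniformlyOn_singleton]
    simpa only [Function.comp_def, Function.iterate_add_apply] using
      (hesc u huU).comp (tendsto_add_atTop_nat N)
  have hfrE : EscapesUniformlyOn f (frontier G) :=
    hV.escapesUniformlyOn (hNV ⟨u, huU, rfl⟩) hw hfr
      (hb.isCompact_closure.of_isClosed_subset isClosed_frontier frontier_subset_closure)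
  have hnot := hV.not_escapesUniformlyOn hG hb h0 hsur.1 hfr
  simp only [EscapesUniformlyOn, not_forall, not_eventually] at hnot
  obtain ⟨R₀, hR₀⟩ := hnot
  -- The ball of radius `max R R₀` meets `f^k(G)` because of `R₀` but misses its frontier, so it
  -- lies inside.
  obtain ⟨k, hk, h1, h2⟩ := (hR₀.and_eventually ((hfrE (max R R₀)).and
    ((tendsto_add_atTop_nat 1).eventually (hfrE R)))).exists
  push Not at hk
  obtain ⟨z, hzG, hz⟩ := hk
  have hop : IsOpenMap f^[k] := hf.isOpenMap_iterate k
  have hfront := hop.frontier_image_subset (hf.1.continuous.iterate k) hG hb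
  refine ⟨f^[k] '' G, hop _ hG, (hb.isCompact_closure.image
    (hf.1.continuous.iterate k)).isBounded.subset (image_mono subset_closure), ?_, ?_⟩
  · refine (Metric.closedBall_subset_closedBall (le_max_left R R₀)).trans ?_
    refine (convex_closedBall (0 : ℂ) (max R R₀)).isPreconnected.subset_of_disjoint_frontier
      (hop _ hG) ⟨f^[k] z, ?_, z, hzG, rfl⟩ (disjoint_left.2 fun v hv hv' => ?_)
    · exact mem_closedBall_zero_iff.2 (hz.trans (le_max_right _ _))
    · obtain ⟨y, hy, rfl⟩ := hfront hv'
      exact (h1 y hy).not_ge (mem_closedBall_zero_iff.1 hv)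
  · intro v hv
    obtain ⟨y, hy, rfl⟩ := hfront hv
    simpa only [Function.iterate_succ_apply'] using h2 y hy

/-! ### Baker omitted values -/

theorem continuous_sphericalDist_infty : Continuous fun z : ℂ =>
    sphericalDist z OnePoint.infty := by
  simp only [sphericalDist, chordalDist_coe_infty]
  refine continuous_const.mul (Real.continuous_arcsin.comp ?_)
  refine (continuous_const.div (by fun_prop) fun z => ?_).div_const _
  positivity

/-- The sine of half the spherical distance to `∞` is `1/√(1 + ‖z‖²)`. This turns distance `r` from
`∞` into a bound on the modulus. -/
theorem norm_mul_sin_sphericalDist_infty_le (z : ℂ) :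
    ‖z‖ * Real.sin (sphericalDist z OnePoint.infty / 2) ≤ 1 := by
  have h1 : 1 ≤ √(1 + ‖z‖ ^ 2) := Real.one_le_sqrt.2 (by nlinarith [sq_nonneg ‖z‖])
  have h2 : ‖z‖ ≤ √(1 + ‖z‖ ^ 2) := Real.le_sqrt_of_sq_le (by linarith)
  have h3 : chordalDist z OnePoint.infty / 2 = 1 / √(1 + ‖z‖ ^ 2) := by
    rw [chordalDist_coe_infty]; ring
  have h4 : 1 / √(1 + ‖z‖ ^ 2) ≤ 1 := (div_le_one (by linarith)).2 h1
  rw [sphericalDist, mul_div_cancel_left₀ _ two_ne_zero, h3,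
    Real.sin_arcsin (by linarith [show 0 ≤ 1 / √(1 + ‖z‖ ^ 2) by positivity]) h4,
    mul_one_div]
  exact (div_le_one (by linarith)).2 h2

theorem IsBakerWanderingDomain.isBakerOmittedValue_infty {f : ℂ → ℂ} {U : Set ℂ}
    (hf : IsTranscendentalEntire f) (hU : IsBakerWanderingDomain f U) :
    IsBakerOmittedValue (fun z => (f z : OnePoint ℂ)) OnePoint.infty := by
  -- The choice `r₀ = 1` only serves to keep `r / 2` in `(0, π)`, where the sine is positive.
  refine ⟨fun z => OnePoint.coe_ne_infty _, 1, one_pos, fun r hr hr1 x hx => ?_⟩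
  set S := frontier ((fun z => (f z : OnePoint ℂ)) ⁻¹' sphericalBall OnePoint.infty r)
  have hsin : 0 < Real.sin (r / 2) :=
    Real.sin_pos_of_pos_of_lt_pi (by linarith) (by linarith [Real.pi_gt_three])
  have hbd : ∀ z ∈ S, ‖f z‖ ≤ 1 / Real.sin (r / 2) := by
    intro z hz
    have hz' : sphericalDist (f z) OnePoint.infty = r :=
      frontier_lt_subset_eq (continuous_sphericalDist_infty.comp hf.1.continuous)
        continuous_const hz
    rw [le_div_iff₀ hsin, ← hz']
    exact norm_mul_sin_sphericalDist_infty_le _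
  obtain ⟨G, hG, hb, hball, hfr⟩ :=
    hU.exists_isOpen_isBounded hf (max ‖x‖ (1 / Real.sin (r / 2)))
  refine hb.subset (isPreconnected_connectedComponentIn.subset_of_disjoint_frontier hG
    ⟨x, mem_connectedComponentIn hx, hball ?_⟩ (disjoint_left.2 fun z hz hz' => ?_))
  · exact mem_closedBall_zero_iff.2 (le_max_left _ _)
  · exact ((le_max_right _ _).trans_lt (hfr z hz')).not_ge
      (hbd z (connectedComponentIn_subset _ _ hz))

/-- A function with a Baker wandering domain takes every finite value. -/
theorem IsBakerWanderingDomain.surjective {f : ℂ → ℂ} {U : Set ℂ}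
    (hf : IsTranscendentalEntire f) (hU : IsBakerWanderingDomain f U) :
    Function.Surjective f := by
  intro a
  by_contra! ha
  have hne : ∀ z, f z - a ≠ 0 := fun z => sub_ne_zero.2 (ha z)
  have hd : Differentiable ℂ fun z => (f z - a)⁻¹ := (hf.1.sub_const a).inv hne
  have hle : ∀ M : ℝ, 0 < M → ‖(f 0 - a)⁻¹‖ ≤ M⁻¹ := by
    intro M hM
    -- The extra `‖a‖` gives `M < ‖f z - a‖` on the frontier.
    obtain ⟨G, hG, hb, hball, hfr⟩ := hU.exists_isOpen_isBounded hf (M + ‖a‖)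
    refine Complex.norm_le_of_forall_mem_frontier_norm_le hb hd.diffContOnCl
      (f := fun z => (f z - a)⁻¹) (fun z hz => ?_)
      (subset_closure (hball (Metric.mem_closedBall_self (by positivity))))
    rw [norm_inv]
    exact inv_anti₀ hM (by linarith [hfr z hz, norm_sub_norm_le (f z) a])
  have hpos : 0 < ‖f 0 - a‖ := norm_pos_iff.2 (hne 0)
  have := hle (‖f 0 - a‖ + 1) (by linarith)
  rw [norm_inv, inv_le_inv₀ hpos (by linarith)] at this
  linarith

end BakerOmitted

theorem mainTheorem3 (f : ℂ → ℂ) (hf : BakerOmitted.IsTranscendentalEntire f)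
    (hB : ∃ U : Set ℂ, BakerOmitted.IsBakerWanderingDomain f U) :
    BakerOmitted.IsBakerOmittedValue (fun z => (f z : OnePoint ℂ)) OnePoint.infty ∧
      ∀ a : OnePoint ℂ, BakerOmitted.IsBakerOmittedValue (fun z => (f z : OnePoint ℂ)) a →
        a = OnePoint.infty := by
  obtain ⟨U, hU⟩ := hB
  refine ⟨hU.isBakerOmittedValue_infty hf, fun a ha => ?_⟩
  by_contra hne
  obtain ⟨b, rfl⟩ := OnePoint.ne_infty_iff_exists.1 hne
  obtain ⟨z, hz⟩ := hU.surjective hf b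
  exact ha.1 z (congrArg _ hz)
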